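/- Let $k$ be a field with $|k|\ge\aleph_1$ and let $R=k[X_1,X_2]$ be the polynomial ring in two variables. For an integral domain $A$, let $S=A\setminus\{0\}$, preordered by divisibility, and let $\widehat A=\varprojlim_{s\in S}A/sA$ be the adic completion of $A$, that is, its completion in the adic topology, in which the nonzero principal ideals $sA$ form a basis of neighbourhoods of $0$. Call $A$ *complete* if the canonical ring homomorphism $A\to\widehat A$ is an isomorphism. Then $R$ is complete, and for every maximal ideal $\mathfrak m$ of $R$ the localization $R_{\mathfrak m}$ is complete. -/

import Mathlib

/-- The adic completion of a (noetherian) domain `R`: the inverse limit of the quotient rings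
`R / sR`, where `s` runs over the nonzero elements of `R`, preordered by divisibility. It is
realized as the ring of compatible families: whenever `s ∣ t`, the projection `R / tR → R / sR`
maps the component at `t` to the component at `s`. -/
def DivisibilityCompletion (R : Type*) [CommRing R] :
    Subring (∀ s : {s : R // s ≠ 0}, R ⧸ Ideal.span {(s : R)}) where
  carrier := {x | ∀ (s t : {s : R // s ≠ 0}) (h : (s : R) ∣ (t : R)),
    Ideal.Quotient.factor (Ideal.span_singleton_le_span_singleton.mpr h) (x t) = x s}
  mul_mem' := fun {x y} hx hy s t h => by
    simp only [Pi.mul_apply, map_mul, hx s t h, hy s t h]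
  one_mem' := fun s t h => by simp only [Pi.one_apply, map_one]
  add_mem' := fun {x y} hx hy s t h => by
    simp only [Pi.add_apply, map_add, hx s t h, hy s t h]
  zero_mem' := fun s t h => by simp only [Pi.zero_apply, map_zero]
  neg_mem' := fun {x} hx s t h => by
    simp only [Pi.neg_apply, map_neg, hx s t h]

/-- The canonical map from `R` to its adic completion, sending `r` to the family of its residue
classes. -/
def DivisibilityCompletion.of (R : Type*) [CommRing R] : R →+* DivisibilityCompletion R :=
  RingHom.codRestrict
    (RingHom.pi fun s : {s : R // s ≠ 0} => Ideal.Quotient.mk (Ideal.span {(s : R)}))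
    (DivisibilityCompletion R) (fun r s t h => Ideal.Quotient.factor_mk _ r)

/-- `R` is complete in its adic topology (the one defined by all nonzero principal ideals):
the canonical map from `R` to its adic completion is an isomorphism. -/
def IsDivisibilityComplete (R : Type*) [CommRing R] : Prop :=
  Function.Bijective (DivisibilityCompletion.of R)

/-!
Both rings are non-fields, so only surjectivity of `A → Â` is at stake: a family of residue classes,
one modulo each nonzero `s` and compatible under divisibility, must come from one element of `A`
(`HasCoherentLimits`). In both cases uncountability of `k` turns a one-parameter family of
restrictions, each of finite but unknown degree, into an infinite subfamily of constant degree.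

For `k[X][Y]`, restrict the family to the lines `X = a` and `Y = b`. Infinitely many of the
polynomials on the lines `X = a` have the same degree, so they interpolate to a polynomial `r` in
two variables, and `r` agrees with the family on all lines `Y = b`. An element divisible by `s` on
infinitely many lines of both directions is divisible by `s` up to a polynomial in `X`, and also up
to a polynomial in `Y`, hence is divisible by `s` (`Polynomial.hasCoherentLimits_bivariate`).

For the local ring at the origin, blow up: under `(X, Y) ↦ (X, TX)` the family defines a power
series `F` in `X` over `k[T]`. Its specialization at `T = a` is the value of the family on the line
`Y = aX`, a rational function of `X`. For infinitely many `a` the degree is the same, and vanishing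
of minors shows that `F` itself is rational (`PowerSeries.exists_mul_eq_of_infinite`). Closedness of
principal ideals shows that the fraction lies in the local ring and is the limit
(`hasCoherentLimits_localization_origin`).

A general maximal ideal is generated by polynomials `p(X)` and `q(X, Y)`, monic in `X` and `Y`
respectively. Then `k[X, Y]` is finite and flat over its polynomial subring `k[p, q]`, and the local
ring of the maximal ideal is finite free over the local ring of `k[p, q]` at the origin. Limits of
coherent families exist in a finite free extension by taking coordinates
(`HasCoherentLimits.of_finite_free`).
-/

/-! ### Coherent families -/

/-- A family `g` of elements of `A`, indexed by `A` itself, is coherent if `g t` lifts the residue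
class of `g s` whenever `s` divides `t ≠ 0`. Coherent families are the lifts to `A` of the elements
of the completion; the value `g 0` carries no information. -/
def IsCoherentFamily {A : Type*} [CommRing A] (g : A → A) : Prop :=
  ∀ s t, t ≠ 0 → s ∣ t → s ∣ g t - g s

/-- Every coherent family of `A` is congruent to a single element of `A` modulo every nonzero
element. This is surjectivity of `A → Â`, phrased without quotient rings. -/
def HasCoherentLimits (A : Type*) [CommRing A] : Prop :=
  ∀ g : A → A, IsCoherentFamily g → ∃ r, ∀ s, s ≠ 0 → s ∣ g s - r

theorem HasCoherentLimits.isDivisibilityComplete {A : Type*} [CommRing A] [IsDomain A]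
    (h : HasCoherentLimits A) (hA : ¬ IsField A) : IsDivisibilityComplete A := by
  constructor
  · rw [injective_iff_map_eq_zero]
    intro r hr
    by_contra hr0
    obtain ⟨p, hp0, hp⟩ := Ring.exists_not_isUnit_of_not_isField hA
    have h1 : (Ideal.Quotient.mk (Ideal.span {r * p})) r = 0 :=
      congrFun (congrArg Subtype.val hr) ⟨r * p, mul_ne_zero hr0 hp0⟩
    rw [Ideal.Quotient.eq_zero_iff_dvd] at h1
    obtain ⟨c, hc⟩ := h1
    refine hp (IsUnit.of_mul_eq_one c (mul_left_cancel₀ hr0 ?_))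
    rw [← mul_assoc, ← hc, mul_one]
  · intro x
    have hl : ∀ s : {s : A // s ≠ 0}, ∃ r : A, Ideal.Quotient.mk (Ideal.span {(s : A)}) r = x.1 s :=
      fun s => Ideal.Quotient.mk_surjective _
    choose l hl using hl
    classical
    have hg : IsCoherentFamily (fun s => if hs : s ≠ 0 then l ⟨s, hs⟩ else 0) := by
      intro s t ht hst
      have hs : s ≠ 0 := fun h0 => ht (by simpa [h0] using hst)
      simp only [dif_pos ht, dif_pos hs]
      have := x.2 ⟨s, hs⟩ ⟨t, ht⟩ hst
      rw [← hl, ← hl, Ideal.Quotient.factor_mk] at this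
      rw [← Ideal.mem_span_singleton]
      exact Ideal.Quotient.eq.mp this
    obtain ⟨r, hr⟩ := h _ hg
    refine ⟨r, Subtype.ext (funext fun s => ?_)⟩
    have := hr s s.2
    simp only [dif_pos s.2] at this
    rw [← hl s]
    refine (Ideal.Quotient.eq.mpr ?_).symm
    exact Ideal.mem_span_singleton.mpr this

theorem HasCoherentLimits.of_ringEquiv {A B : Type*} [CommRing A] [CommRing B] (e : A ≃+* B)
    (h : HasCoherentLimits A) : HasCoherentLimits B := by
  intro g hg
  obtain ⟨r, hr⟩ := h (fun a => e.symm (g (e a))) fun s t ht hst => by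
    simpa using map_dvd e.symm (hg (e s) (e t) (by simpa using ht) (map_dvd e hst))
  refine ⟨e r, fun s hs => ?_⟩
  simpa using map_dvd e (hr (e.symm s) (by simpa using hs))

/-- Coordinatewise limits exist, and every nonzero element of `B` divides a nonzero element
of `A`. -/
theorem HasCoherentLimits.of_finite_free {A B : Type*} [CommRing A] [IsDomain A] [CommRing B]
    [IsDomain B] [Algebra A B] [Module.Finite A B] [Module.Free A B]
    (h : HasCoherentLimits A) : HasCoherentLimits B := by
  intro g hg
  have hinj : Function.Injective (algebraMap A B) := FaithfulSMul.algebraMap_injective A B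
  let b := Module.Free.chooseBasis A B
  have hr : ∀ i, ∃ r, ∀ s : A, s ≠ 0 → s ∣ b.repr (g (algebraMap A B s)) i - r := fun i => by
    refine h (fun s => b.repr (g (algebraMap A B s)) i) fun s t ht hst => ?_
    obtain ⟨c, hc⟩ := hg (algebraMap A B s) (algebraMap A B t)
      ((map_ne_zero_iff _ hinj).mpr ht) (map_dvd _ hst)
    refine ⟨b.repr c i, ?_⟩
    rw [← Finsupp.sub_apply, ← map_sub, hc, ← Algebra.smul_def, map_smul, Finsupp.smul_apply,
      smul_eq_mul]
  choose r hr using hr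
  refine ⟨∑ i, r i • b i, fun s hs => ?_⟩
  have key : ∀ a : A, a ≠ 0 → algebraMap A B a ∣ g (algebraMap A B a) - ∑ i, r i • b i := by
    intro a ha
    choose c hc using fun i => hr i a ha
    refine ⟨∑ i, c i • b i, ?_⟩
    conv_lhs => rw [← b.sum_repr (g (algebraMap A B a)), ← Finset.sum_sub_distrib]
    rw [← Algebra.smul_def, Finset.smul_sum]
    refine Finset.sum_congr rfl fun i _ => ?_
    rw [← sub_smul, hc, mul_smul]
  obtain ⟨a, ha, hsa⟩ := (Algebra.IsIntegral.isIntegral (R := A) s).isAlgebraic.exists_nonzero_dvd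
    (mem_nonZeroDivisors_of_ne_zero hs)
  have h1 := hg s (algebraMap A B a) ((map_ne_zero_iff _ hinj).mpr ha) hsa
  have h2 := hsa.trans (key a ha)
  simpa using dvd_sub h2 h1

/-! ### The polynomial ring in two variables -/

theorem exists_infinite_fiber_nat {α : Type*} [Uncountable α] (f : α → ℕ) :
    ∃ d, {a | f a = d}.Infinite := by
  by_contra! h
  refine not_countable (α := α) (Set.countable_univ_iff.mp ?_)
  rw [show (Set.univ : Set α) = ⋃ d, {a | f a = d} by ext; simp]
  exact Set.countable_iUnion fun d => (h d).countable

namespace Polynomial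

open scoped Bivariate

/-- Pseudo-division: division with remainder works after multiplying the dividend by a power of
the leading coefficient of the divisor. -/
theorem exists_pseudo_division {D : Type*} [CommRing D] [IsDomain D] {s : D[X]} (hs : s ≠ 0)
    (f : D[X]) : ∃ (N : ℕ) (q r : D[X]),
      C (s.leadingCoeff ^ N) * f = s * q + r ∧ r.degree < s.degree := by
  induction hn : f.degree using WellFoundedLT.induction generalizing f with
  | ind n ih =>
    subst hn
    by_cases hlt : f.degree < s.degree
    · exact ⟨0, 0, f, by simp, hlt⟩
    · have hf : f ≠ 0 := by
        rintro rfl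
        exact hlt (by simpa [bot_lt_iff_ne_bot, degree_eq_bot] using hs)
      have hl : s.leadingCoeff ≠ 0 := leadingCoeff_ne_zero.mpr hs
      have hle : s.natDegree ≤ f.natDegree := natDegree_le_natDegree (not_lt.mp hlt)
      set t := C f.leadingCoeff * X ^ (f.natDegree - s.natDegree) with ht
      have hdeg : (C s.leadingCoeff * f).degree = f.degree := by
        rw [degree_mul, degree_C hl, zero_add]
      have hlt' : (C s.leadingCoeff * f - s * t).degree < f.degree := by
        rw [← hdeg]
        refine degree_sub_lt_left ?_ (mul_ne_zero (C_ne_zero.mpr hl) hf) ?_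
        · rw [hdeg, degree_mul, ht, degree_C_mul_X_pow _ (leadingCoeff_ne_zero.mpr hf),
            degree_eq_natDegree hf, degree_eq_natDegree hs, ← Nat.cast_add,
            Nat.add_sub_cancel' hle]
        · simp [ht]
      obtain ⟨N, q, r, h, hr⟩ := ih _ hlt' _ rfl
      refine ⟨N + 1, C (s.leadingCoeff ^ N) * t + q, r, ?_, hr⟩
      rw [pow_succ, C_mul, mul_add, add_assoc, ← h]
      ring

variable {k : Type*} [Field k]

theorem eq_zero_of_infinite_map_eval_eq_zero {S : Set k} (hS : S.Infinite) {f : k[X][Y]}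
    (h : ∀ a ∈ S, f.map (evalRingHom a) = 0) : f = 0 := by
  ext1 n
  refine eq_zero_of_infinite_isRoot _ (hS.mono fun a ha => ?_)
  simpa using congrArg (coeff · n) (h a ha)

/-- If `s` divides `f` on infinitely many vertical lines `X = a`, then it does so up to a
polynomial in `X` alone. -/
theorem exists_dvd_C_mul_of_infinite {S : Set k} (hS : S.Infinite) {f s : k[X][Y]} (hs : s ≠ 0)
    (h : ∀ a ∈ S, s.map (evalRingHom a) ∣ f.map (evalRingHom a)) :
    ∃ u : k[X], u ≠ 0 ∧ s ∣ C u * f := by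
  obtain ⟨N, q, r, hqr, hr⟩ := exists_pseudo_division hs f
  have hl : s.leadingCoeff ≠ 0 := leadingCoeff_ne_zero.mpr hs
  refine ⟨s.leadingCoeff ^ N, pow_ne_zero _ hl, q, ?_⟩
  suffices r = 0 by simpa [this] using hqr
  -- The lines on which the degree of `s` drops have to be avoided.
  have hfin : {a | s.leadingCoeff.IsRoot a}.Finite := by
    by_contra hinf
    exact hl (eq_zero_of_infinite_isRoot _ hinf)
  refine eq_zero_of_infinite_map_eval_eq_zero (hS.sdiff hfin) fun a ha => ?_
  have h1 : s.map (evalRingHom a) ∣ r.map (evalRingHom a) := by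
    have h2 := congrArg (Polynomial.map (evalRingHom a)) hqr
    rw [Polynomial.map_add, Polynomial.map_mul, Polynomial.map_mul] at h2
    exact (dvd_add_right (dvd_mul_right _ _)).mp (h2 ▸ (h a ha.1).mul_left _)
  refine eq_zero_of_dvd_of_degree_lt h1 ?_
  rw [degree_map_eq_of_leadingCoeff_ne_zero (evalRingHom a) ha.2]
  exact degree_map_le.trans_lt hr

theorem map_evalRingHom_swap (b : k) (f : k[X][Y]) :
    (Bivariate.swap f).map (evalRingHom b) = f.eval (C b) := by
  have : ((mapRingHom (evalRingHom b)).comp (Bivariate.swap (R := k) : k[X][Y] →+* k[X][Y])) =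
      evalRingHom (C b) := by
    refine ringHom_ext' (ringHom_ext' ?_ ?_) ?_
    · ext x
      simp [Bivariate.swap_C_C]
    · simp [Bivariate.swap_X]
    · simp [Bivariate.swap_Y]
  exact DFunLike.congr_fun this f

theorem isRelPrime_C_map_C {u v : k[X]} (hu : u ≠ 0) (hv : v ≠ 0) :
    IsRelPrime (C u : k[X][Y]) (v.map C) := by
  intro d hdu hdv
  obtain ⟨c, hc⟩ := hdu
  have hd : d.natDegree = 0 := by
    have h := congrArg natDegree hc
    have h0 : d * c ≠ 0 := hc ▸ C_ne_zero.mpr hu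
    rw [natDegree_C, natDegree_mul (left_ne_zero_of_mul h0) (right_ne_zero_of_mul h0)] at h
    lia
  rw [eq_C_of_natDegree_eq_zero hd] at hdv ⊢
  rw [C_dvd_iff_dvd_coeff] at hdv
  have h := hdv v.natDegree
  rw [coeff_map] at h
  exact isUnit_C.mpr (isUnit_of_dvd_unit h
    (isUnit_C.mpr (isUnit_iff_ne_zero.mpr (leadingCoeff_ne_zero.mpr hv))))

/-- If `s` divides `f` on infinitely many vertical and infinitely many horizontal lines, then
`s` divides `f`. -/
theorem dvd_of_infinite_of_infinite {S T : Set k} (hS : S.Infinite) (hT : T.Infinite)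
    {f s : k[X][Y]} (hs : s ≠ 0)
    (hx : ∀ a ∈ S, s.map (evalRingHom a) ∣ f.map (evalRingHom a))
    (hy : ∀ b ∈ T, s.eval (C b) ∣ f.eval (C b)) : s ∣ f := by
  obtain ⟨u, hu, h1⟩ := exists_dvd_C_mul_of_infinite hS hs hx
  obtain ⟨v, hv, h2⟩ := exists_dvd_C_mul_of_infinite hT (f := Bivariate.swap f)
    (s := Bivariate.swap s) (by simpa using hs)
    (fun b hb => by simpa only [map_evalRingHom_swap] using hy b hb)
  have h3 : s ∣ v.map C * f := by
    have h := _root_.map_dvd (Bivariate.swap (R := k)) h2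
    rwa [map_mul, Bivariate.swap_C, Bivariate.swap_swap_apply, Bivariate.swap_swap_apply] at h
  obtain ⟨α, hα⟩ := h1
  obtain ⟨β, hβ⟩ := h3
  have h4 : C u * β = v.map C * α := by
    refine mul_left_cancel₀ hs ?_
    rw [mul_left_comm, ← hβ, mul_left_comm s, ← hα]
    ring
  obtain ⟨γ, rfl⟩ := (isRelPrime_C_map_C hu hv).dvd_of_dvd_mul_left ⟨β, h4.symm⟩
  refine ⟨γ, mul_left_cancel₀ (C_ne_zero.mpr hu) ?_⟩
  rw [hα]
  ring

/-- The restrictions of a coherent family to the lines `X = a` have the same degree for infinitely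
many `a`, because `k` is uncountable. Interpolating along the lines `Y = b` gives the limit. -/
theorem hasCoherentLimits_bivariate [Uncountable k] : HasCoherentLimits k[X][Y] := by
  classical
  intro g hg
  have hX : ∀ a : k, (C (X - C a) : k[X][Y]) ≠ 0 := fun a => C_ne_zero.mpr (X_sub_C_ne_zero a)
  have hY : ∀ b : k, (X - C (C b) : k[X][Y]) ≠ 0 := fun b => X_sub_C_ne_zero _
  set F : k → k[X] := fun a => (g (C (X - C a))).map (evalRingHom a) with hF
  set H : k → k[X] := fun b => (g (X - C (C b))).eval (C b) with hH
  have hX0 : ∀ a, (C (X - C a) : k[X][Y]).map (evalRingHom a) = 0 := fun a => by simp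
  have hFs : ∀ (a : k) (s : k[X][Y]), s ≠ 0 →
      s.map (evalRingHom a) ∣ (g s).map (evalRingHom a) - F a := by
    intro a s hs
    have hne := mul_ne_zero (hX a) hs
    obtain ⟨c, hc⟩ := hg _ _ hne (dvd_mul_right _ _)
    have h1 := Polynomial.map_dvd (evalRingHom a) (hg _ _ hne (dvd_mul_left s (C (X - C a))))
    have h2 := congrArg (Polynomial.map (evalRingHom a)) hc
    rw [Polynomial.map_mul, hX0, zero_mul, Polynomial.map_sub, sub_eq_zero] at h2
    rw [Polynomial.map_sub, h2] at h1
    exact (dvd_sub_comm).mp h1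
  have hHs : ∀ (b : k) (s : k[X][Y]), s ≠ 0 → s.eval (C b) ∣ (g s).eval (C b) - H b := by
    intro b s hs
    have hne := mul_ne_zero (hY b) hs
    obtain ⟨c, hc⟩ := hg _ _ hne (dvd_mul_right _ _)
    have h1 := eval_dvd (x := C b) (hg _ _ hne (dvd_mul_left s (X - C (C b))))
    have h2 := congrArg (eval (C b)) hc
    rw [eval_mul, eval_sub, eval_sub, eval_X, eval_C, sub_self, zero_mul, sub_eq_zero] at h2
    rw [eval_sub, h2] at h1
    exact (dvd_sub_comm).mp h1
  have hFH : ∀ a b, (F a).eval b = (H b).eval a := by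
    intro a b
    obtain ⟨c, hc⟩ := hFs a _ (hY b)
    have h2 := congrArg (eval b) hc
    simp only [Polynomial.map_sub, map_X, map_C, coe_evalRingHom, eval_C, eval_mul, eval_sub,
      eval_X, sub_self, zero_mul] at h2
    rw [sub_eq_zero, map_evalRingHom_eval] at h2
    exact h2.symm
  obtain ⟨d, hd⟩ := exists_infinite_fiber_nat fun a => (F a).natDegree
  have : Infinite k := inferInstance
  obtain ⟨I, hI⟩ := Infinite.exists_subset_card_eq k (d + 1)
  set r : k[X][Y] := ∑ b ∈ I, C (H b) * (Lagrange.basis I id b).map C with hr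
  have hrF : ∀ a, (F a).natDegree = d → r.map (evalRingHom a) = F a := by
    intro a ha
    rw [Lagrange.eq_interpolate_of_eval_eq (s := I) (v := id) (fun b => (H b).eval a)
      Function.injective_id.injOn (f := F a) ?_ fun b _ => hFH a b, Lagrange.interpolate_apply, hr,
      Polynomial.map_sum]
    · refine Finset.sum_congr rfl fun b _ => ?_
      rw [Polynomial.map_mul, map_C, Polynomial.map_map]
      congr 1
      rw [show (evalRingHom a).comp C = RingHom.id k from RingHom.ext fun x => eval_C,
        Polynomial.map_id]
    · rw [hI]
      exact degree_le_natDegree.trans_lt (by rw [ha]; exact_mod_cast Nat.lt_succ_self d)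
  have hrH : ∀ b, r.eval (C b) = H b := by
    intro b
    refine eq_of_infinite_eval_eq _ _ (hd.mono fun a ha => ?_)
    change (r.eval (C b)).eval a = (H b).eval a
    rw [← hFH, ← hrF a ha]
    exact (map_evalRingHom_eval a b r).symm
  refine ⟨r, fun s hs => dvd_of_infinite_of_infinite hd Set.infinite_univ hs
    (fun a ha => ?_) fun b _ => ?_⟩
  · rw [Polynomial.map_sub, hrF a ha]
    exact hFs a s hs
  · rw [eval_sub, hrH]
    exact hHs b s hs

end Polynomial

/-! ### Power series that are rational on infinitely many fibres -/

namespace PowerSeries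

open Polynomial

theorem coeff_coe_mul_of_natDegree_le {R : Type*} [CommRing R] {d : ℕ} {v : R[X]}
    (hv : v.natDegree ≤ d) (F : R⟦X⟧) (n : ℕ) :
    coeff (n + d + 1) ((v : R⟦X⟧) * F) =
      ∑ j : Fin (d + 1), v.coeff j * coeff (n + d + 1 - j) F := by
  rw [coeff_mul, Finset.Nat.sum_antidiagonal_eq_sum_range_succ
    (fun i j => coeff i (v : R⟦X⟧) * coeff j F),
    Fin.sum_univ_eq_sum_range (fun j => v.coeff j * coeff (n + d + 1 - j) F)]
  symm
  simp only [Polynomial.coeff_coe]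
  refine Finset.sum_subset (fun j => by simp only [Finset.mem_range]; lia) fun j _ hj => ?_
  rw [Polynomial.coeff_eq_zero_of_natDegree_lt, zero_mul]
  simp only [Finset.mem_range] at hj
  lia

/-- Rationality with denominator of degree at most `d` means that the vectors of `d + 1` consecutive
coefficients satisfy a common linear relation. If that happens for the specializations `T = a` at
infinitely many `a`, then all maximal minors of the family of these vectors vanish identically in
`T`, so there is a relation with coefficients in `k[T]`. -/
theorem exists_mul_eq_of_infinite {k : Type*} [Field k] (F : k[X]⟦X⟧) {S : Set k}
    (hS : S.Infinite) {d : ℕ}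
    (h : ∀ a ∈ S, ∃ u v : k[X], v ≠ 0 ∧ u.natDegree ≤ d ∧ v.natDegree ≤ d ∧
      (v : k⟦X⟧) * map (evalRingHom a) F = u) :
    ∃ U V : k[X][X], V ≠ 0 ∧ (V : k[X]⟦X⟧) * F = U := by
  classical
  let K := FractionRing k[X]
  have hinj : Function.Injective (algebraMap k[X] K) := IsFractionRing.injective _ _
  let w : ℕ → Fin (d + 1) → K := fun n j => algebraMap k[X] K (coeff (n + d + 1 - j) F)
  have hspan : Submodule.span K (Set.range w) < ⊤ := by
    rw [lt_top_iff_ne_top]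
    intro htop
    obtain ⟨f, hf, -, hli⟩ := Submodule.exists_fun_fin_finrank_span_eq K (Set.range w)
    have hfr : d + 1 = Module.finrank K (Submodule.span K (Set.range w)) := by
      rw [htop, finrank_top, Module.finrank_fin_fun]
    choose n hn using fun i : Fin (d + 1) => hf (Fin.cast hfr i)
    have hli' : LinearIndependent K fun i : Fin (d + 1) => w (n i) := by
      simp only [hn]
      exact hli.comp _ (Fin.cast_injective hfr)
    let A : Matrix (Fin (d + 1)) (Fin (d + 1)) k[X] :=
      Matrix.of fun i j => coeff (n i + d + 1 - j) F
    have hA : IsUnit ((algebraMap k[X] K).mapMatrix A) :=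
      Matrix.linearIndependent_rows_iff_isUnit.mp hli'
    have hA0 : A.det ≠ 0 := by
      rw [Matrix.isUnit_iff_isUnit_det, ← RingHom.map_det] at hA
      intro h0
      rw [h0, map_zero] at hA
      exact not_isUnit_zero hA
    refine hA0 (eq_zero_of_infinite_isRoot _ (hS.mono fun a ha => ?_))
    change evalRingHom a A.det = 0
    rw [RingHom.map_det]
    obtain ⟨u, v, hv0, hu, hv, huv⟩ := h a ha
    refine Matrix.exists_mulVec_eq_zero_iff.mp ⟨fun j => v.coeff j, fun h0 => hv0 ?_, ?_⟩
    · ext j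
      by_cases hj : j < d + 1
      · exact congrFun h0 ⟨j, hj⟩
      · exact Polynomial.coeff_eq_zero_of_natDegree_lt (by lia)
    · ext i
      have h1 := congrArg (coeff (n i + d + 1)) huv
      rw [coeff_coe_mul_of_natDegree_le hv, Polynomial.coeff_coe,
        Polynomial.coeff_eq_zero_of_natDegree_lt (by lia)] at h1
      simpa [Matrix.mulVec, dotProduct, A, mul_comm] using h1
  obtain ⟨φ, hφ, hker⟩ := Submodule.exists_le_ker_of_lt_top _ hspan
  obtain ⟨b, hb⟩ := IsLocalization.exist_integer_multiples_of_finite (nonZeroDivisors k[X])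
    (fun j : Fin (d + 1) => φ (Pi.single j 1))
  choose c hc using hb
  have hb0 : algebraMap k[X] K b ≠ 0 :=
    (map_ne_zero_iff _ hinj).mpr (nonZeroDivisors.ne_zero b.2)
  set V : k[X][X] := ∑ j : Fin (d + 1), Polynomial.monomial j (c j) with hV
  have hVc : ∀ j : Fin (d + 1), V.coeff j = c j := fun j => by
    simp [hV, finsetSum_coeff, Polynomial.coeff_monomial, Fin.val_inj]
  have hVd : V.natDegree ≤ d :=
    natDegree_sum_le_of_forall_le _ _ fun j _ => (natDegree_monomial_le _).trans (by lia)
  refine ⟨trunc (d + 1) ((V : k[X]⟦X⟧) * F), V, fun h0 => hφ ?_, ?_⟩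
  · refine LinearMap.pi_ext' fun j => LinearMap.ext_ring ?_
    have h1 := hc j
    rw [← hVc, h0, Polynomial.coeff_zero, map_zero, Algebra.smul_def] at h1
    simpa [hb0] using h1.symm
  · ext1 m
    rw [Polynomial.coeff_coe, coeff_trunc]
    split_ifs with hm
    · rfl
    · obtain ⟨n, rfl⟩ : ∃ n, m = n + d + 1 := ⟨m - (d + 1), by lia⟩
      rw [coeff_coe_mul_of_natDegree_le hVd]
      apply hinj
      have h1 : φ (w n) = 0 := hker (Submodule.subset_span ⟨n, rfl⟩)
      have h2 : φ (w n) = ∑ j, w n j * φ (Pi.single j 1) := by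
        rw [φ.pi_apply_eq_sum_univ]
        refine Finset.sum_congr rfl fun j _ => ?_
        rw [smul_eq_mul]
        congr 2
        ext i
        simp [Pi.single_apply, eq_comm]
      rw [map_zero, map_sum, ← mul_zero (algebraMap k[X] K b), ← h1, h2, Finset.mul_sum]
      refine Finset.sum_congr rfl fun j _ => ?_
      rw [map_mul, hVc, hc, Algebra.smul_def]
      ring

end PowerSeries

/-! ### The local ring of the affine plane at the origin -/

namespace MvPolynomial

open Polynomial (evalRingHom)
open Finsupp (single)

variable (k : Type*) [Field k]

instance isMaximal_idealOfVars : (idealOfVars (Fin 2) k).IsMaximal := by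
  have : idealOfVars (Fin 2) k = RingHom.ker (constantCoeff (R := k) (σ := Fin 2)) := by
    ext f
    rw [← pow_one (idealOfVars (Fin 2) k), mem_pow_idealOfVars_iff', RingHom.mem_ker]
    simp [constantCoeff_eq, Finsupp.degree_eq_zero_iff]
  rw [this]
  exact RingHom.ker_isMaximal_of_surjective _ fun c => ⟨C c, constantCoeff_C _ _⟩

/-- The chart `(X, Y) ↦ (X, TX)` of the blow-up of the plane at the origin, as a homomorphism
`k[X, Y] → k[T]⟦X⟧`. -/
noncomputable def blowup : MvPolynomial (Fin 2) k →+* PowerSeries (Polynomial k) :=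
  eval₂Hom (PowerSeries.C.comp Polynomial.C) ![PowerSeries.X, PowerSeries.X * PowerSeries.C Polynomial.X]

variable {k}

@[simp]
theorem blowup_C (c : k) : blowup k (C c) = PowerSeries.C (Polynomial.C c) := by
  simp [blowup]

@[simp]
theorem blowup_X_zero : blowup k (X 0) = PowerSeries.X := by
  simp [blowup]

@[simp]
theorem blowup_X_one : blowup k (X 1) = PowerSeries.X * PowerSeries.C Polynomial.X := by
  simp [blowup]

theorem coeff_coeff_blowup (f : MvPolynomial (Fin 2) k) {n j : ℕ} (hj : j ≤ n) :
    (PowerSeries.coeff n (blowup k f)).coeff j = f.coeff (single 0 (n - j) + single 1 j) := by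
  induction f using MvPolynomial.induction_on' with
  | add p q hp hq => simp [hp, hq]
  | monomial m c =>
    have h1 : blowup k (monomial m c) =
        PowerSeries.C (Polynomial.monomial (m 1) c) * PowerSeries.X ^ (m 0 + m 1) := by
      rw [monomial_eq, Finsupp.prod_fintype _ _ (fun i => pow_zero _), Fin.prod_univ_two, map_mul,
        map_mul, map_pow, map_pow, blowup_C, blowup_X_zero, blowup_X_one, mul_pow, pow_add,
        ← Polynomial.C_mul_X_pow_eq_monomial, map_mul, map_pow]
      ring
    rw [h1, PowerSeries.coeff_C_mul_X_pow, coeff_monomial]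
    have h2 : m = single 0 (n - j) + single 1 j ↔ n = m 0 + m 1 ∧ m 1 = j := by
      rw [Finsupp.ext_iff, Fin.forall_fin_two]
      simp
      lia
    rw [if_congr h2 rfl rfl]
    by_cases h3 : n = m 0 + m 1
    · simp [h3, Polynomial.coeff_monomial]
    · simp [h3]

/-- In the blow-up chart, only polynomials in the `n`-th power of the ideal of the origin become
divisible by `X ^ n`. -/
theorem mem_pow_idealOfVars_of_dvd {n : ℕ} {f : MvPolynomial (Fin 2) k}
    (h : PowerSeries.X ^ n ∣ blowup k f) : f ∈ idealOfVars (Fin 2) k ^ n := by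
  rw [mem_pow_idealOfVars_iff']
  intro m hm
  have hdeg : m.degree = m 0 + m 1 := by
    rw [Finsupp.degree_eq_sum, Fin.sum_univ_two]
  have h1 := coeff_coeff_blowup f (Nat.le_add_left (m 1) (m 0))
  rw [PowerSeries.X_pow_dvd_iff.mp h _ (hdeg ▸ hm), Polynomial.coeff_zero,
    Nat.add_sub_cancel] at h1
  rw [h1]
  congr 1
  ext i
  fin_cases i <;> simp

theorem isUnit_blowup (f : (idealOfVars (Fin 2) k).primeCompl) : IsUnit (blowup k f) := by
  have h : ∀ f, PowerSeries.constantCoeff (blowup k f) = Polynomial.C (constantCoeff f) := by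
    intro f
    have : (PowerSeries.constantCoeff (R := Polynomial k)).comp (blowup k) =
        Polynomial.C.comp constantCoeff := by
      refine ringHom_ext (fun c => by simp) fun i => ?_
      fin_cases i <;> simp
    exact DFunLike.congr_fun this f
  rw [PowerSeries.isUnit_iff_constantCoeff, h, Polynomial.isUnit_C, isUnit_iff_ne_zero]
  intro h0
  refine f.2 ((pow_one (idealOfVars (Fin 2) k)).le (mem_pow_idealOfVars_of_dvd ?_))
  rw [pow_one, PowerSeries.X_dvd_iff, h, h0, map_zero]

/-- On the line `Y = aX`, which is the locus `T = a` in the chart, the restriction of a polynomial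
is a polynomial in `X`. -/
theorem map_evalRingHom_blowup (a : k) (f : MvPolynomial (Fin 2) k) :
    PowerSeries.map (evalRingHom a) (blowup k f) =
      (aeval ![Polynomial.X, Polynomial.X * Polynomial.C a] f : Polynomial k) := by
  have : (PowerSeries.map (evalRingHom a)).comp (blowup k) =
      (Polynomial.coeToPowerSeries.ringHom (R := k)).comp
        (aeval ![Polynomial.X, Polynomial.X * Polynomial.C a] : MvPolynomial (Fin 2) k →ₐ[k] _).toRingHom := by
    refine ringHom_ext (fun c => by simp [Polynomial.algebraMap_eq]) fun i => ?_
    fin_cases i <;> simp [PowerSeries.commute_X _ |>.eq]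
  exact DFunLike.congr_fun this f

theorem exists_blowup_eq_X_pow_mul (V : Polynomial (Polynomial k)) :
    ∃ (M : ℕ) (f : MvPolynomial (Fin 2) k),
      blowup k f = PowerSeries.X ^ M * (V : PowerSeries (Polynomial k)) := by
  induction V using Polynomial.induction_on' with
  | add p q hp hq =>
    obtain ⟨M, f, hf⟩ := hp
    obtain ⟨N, g, hg⟩ := hq
    refine ⟨M + N, X 0 ^ N * f + X 0 ^ M * g, ?_⟩
    rw [map_add, map_mul, map_mul, map_pow, map_pow, hf, hg, blowup_X_zero, Polynomial.coe_add]
    ring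
  | monomial n c =>
    induction c using Polynomial.induction_on' with
    | add p q hp hq =>
      obtain ⟨M, f, hf⟩ := hp
      obtain ⟨N, g, hg⟩ := hq
      refine ⟨M + N, X 0 ^ N * f + X 0 ^ M * g, ?_⟩
      rw [map_add, map_mul, map_mul, map_pow, map_pow, hf, hg, blowup_X_zero, map_add,
        Polynomial.coe_add]
      ring
    | monomial j c =>
      refine ⟨j, C c * X 0 ^ n * X 1 ^ j, ?_⟩
      rw [map_mul, map_mul, map_pow, map_pow, blowup_C, blowup_X_zero, blowup_X_one,
        Polynomial.coe_monomial, PowerSeries.monomial_eq_C_mul_X_pow,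
        ← Polynomial.C_mul_X_pow_eq_monomial, map_mul, map_pow]
      ring

end MvPolynomial

/-- Krull's intersection theorem: nonzero principal ideals of a noetherian local ring are closed. -/
theorem dvd_of_forall_dvd_sub_mem_pow {A : Type*} [CommRing A] [IsNoetherianRing A] [IsLocalRing A]
    {I : Ideal A} (hI : I ≠ ⊤) {s x : A} (h : ∀ n : ℕ, ∃ y ∈ I ^ n, s ∣ y - x) : s ∣ x := by
  rw [← Ideal.Quotient.eq_zero_iff_dvd, ← Submodule.mem_bot A,
    ← Ideal.iInf_pow_smul_eq_bot_of_isLocalRing (M := A ⧸ Ideal.span {s}) I hI, Submodule.mem_iInf]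
  intro n
  obtain ⟨y, hy, hys⟩ := h n
  rw [← (Ideal.Quotient.mk_eq_mk_iff_sub_mem y x).mpr (Ideal.mem_span_singleton.mpr hys)]
  have h1 := Submodule.smul_mem_smul hy
    (Submodule.mem_top : (1 : A ⧸ Ideal.span {s}) ∈ (⊤ : Submodule A (A ⧸ Ideal.span {s})))
  rwa [Algebra.smul_def, mul_one] at h1

open MvPolynomial in
/-- The limit is constructed as a power series on the blow-up of the origin, is shown to be
rational since its restrictions to the lines `Y = aX` are, and lies in the local ring because
principal ideals are closed. -/
theorem hasCoherentLimits_localization_origin {k : Type*} [Field k] [Uncountable k] {A : Type*}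
    [CommRing A] [Algebra (MvPolynomial (Fin 2) k) A]
    [IsLocalization.AtPrime A (idealOfVars (Fin 2) k)] : HasCoherentLimits A := by
  set m := idealOfVars (Fin 2) k with hm
  have : IsDomain A := IsLocalization.isDomain_of_atPrime A m
  have : IsLocalRing A := IsLocalization.AtPrime.isLocalRing A m
  have : IsNoetherianRing A := IsLocalization.isNoetherianRing m.primeCompl A inferInstance
  have hinj : Function.Injective (algebraMap (MvPolynomial (Fin 2) k) A) :=
    IsLocalization.injective A m.primeCompl_le_nonZeroDivisors
  let ι := algebraMap (MvPolynomial (Fin 2) k) A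
  let ψ : A →+* PowerSeries (Polynomial k) := IsLocalization.lift (isUnit_blowup (k := k))
  have hψ : ∀ f, ψ (ι f) = blowup k f := fun f => IsLocalization.lift_eq _ f
  have hψx : ψ (ι (X 0)) = PowerSeries.X := by rw [hψ, blowup_X_zero]
  have hx0 : ι (X 0) ≠ 0 := (map_ne_zero_iff _ hinj).mpr (X_ne_zero 0)
  have hmtop : m.map ι ≠ ⊤ := by
    rw [IsLocalization.AtPrime.map_eq_maximalIdeal m A]
    exact (IsLocalRing.maximalIdeal.isMaximal A).ne_top
  have hmem : ∀ (b : A) (n : ℕ), PowerSeries.X ^ n ∣ ψ b → b ∈ m.map ι ^ n := by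
    intro b n hb
    obtain ⟨⟨u, w⟩, huw⟩ := IsLocalization.surj m.primeCompl b
    have h1 : u ∈ m ^ n := by
      refine mem_pow_idealOfVars_of_dvd ?_
      rw [← hψ, ← huw, map_mul]
      exact hb.mul_right _
    rw [← Ideal.map_pow, ← Ideal.mul_unit_mem_iff_mem _ (IsLocalization.map_units A w), huw]
    exact Ideal.mem_map_of_mem _ h1
  -- A coherent family is zero as soon as the power series attached to it is.
  have hzero : ∀ z : A → A, IsCoherentFamily z →
      (∀ t n, t ≠ 0 → ι (X 0) ^ n ∣ t → PowerSeries.X ^ n ∣ ψ (z t)) → ∀ s, s ≠ 0 → s ∣ z s := by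
    intro z hz hz0 s hs
    refine dvd_of_forall_dvd_sub_mem_pow hmtop fun n => ⟨z (s * ι (X 0) ^ n), hmem _ _ ?_, ?_⟩
    · exact hz0 _ _ (mul_ne_zero hs (pow_ne_zero _ hx0)) (dvd_mul_left _ _)
    · exact hz _ _ (mul_ne_zero hs (pow_ne_zero _ hx0)) (dvd_mul_right _ _)
  intro g hg
  let F : PowerSeries (Polynomial k) :=
    PowerSeries.mk fun n => PowerSeries.coeff n (ψ (g (ι (X 0) ^ (n + 1))))
  have hF : ∀ t n, t ≠ 0 → ι (X 0) ^ n ∣ t → PowerSeries.X ^ n ∣ ψ (g t) - F := by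
    intro t n ht hnt
    rw [PowerSeries.X_pow_dvd_iff]
    intro j hj
    have h1 := map_dvd ψ (hg (ι (X 0) ^ (j + 1)) t ht ((pow_dvd_pow _ hj).trans hnt))
    rw [map_pow, hψx, map_sub, PowerSeries.X_pow_dvd_iff] at h1
    have h2 := h1 j (Nat.lt_succ_self j)
    rw [map_sub] at h2 ⊢
    rwa [PowerSeries.coeff_mk]
  let p : k → A := fun a => ι (X 1 - X 0 * C a)
  let ev : k → PowerSeries (Polynomial k) →+* PowerSeries k :=
    fun a => PowerSeries.map (Polynomial.evalRingHom a)
  have hp : ∀ a, p a ≠ 0 := by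
    intro a h0
    have h1 := congrArg (eval ![0, 1]) ((map_eq_zero_iff _ hinj).mp h0)
    simp at h1
  have hevp : ∀ a, ev a (ψ (p a)) = 0 := by
    intro a
    rw [hψ]
    simp [ev]
  have hevF : ∀ a, ev a (ψ (g (p a))) = ev a F := by
    intro a
    ext n
    have ht : p a * ι (X 0) ^ (n + 1) ≠ 0 := mul_ne_zero (hp a) (pow_ne_zero _ hx0)
    have h1 := map_dvd (ev a) (map_dvd ψ (hg _ _ ht (dvd_mul_right _ _)))
    rw [hevp, zero_dvd_iff, map_sub, map_sub, sub_eq_zero] at h1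
    have h2 := map_dvd (ev a) (hF _ (n + 1) ht (dvd_mul_left _ _))
    rw [map_sub, h1, map_pow, PowerSeries.map_X, PowerSeries.X_pow_dvd_iff] at h2
    have h3 := h2 n (Nat.lt_succ_self n)
    rwa [map_sub, sub_eq_zero] at h3
  have hfrac : ∀ a, ∃ (u : MvPolynomial (Fin 2) k) (w : m.primeCompl), g (p a) * ι w = ι u :=
    fun a => by
      obtain ⟨⟨u, w⟩, h⟩ := IsLocalization.surj m.primeCompl (g (p a))
      exact ⟨u, w, h⟩
  choose u w huw using hfrac
  let P : k → MvPolynomial (Fin 2) k →ₐ[k] Polynomial k :=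
    fun a => aeval ![Polynomial.X, Polynomial.X * Polynomial.C a]
  have hP : ∀ a f, ev a (ψ (ι f)) = (P a f : Polynomial k) := fun a f => by
    rw [hψ]
    exact map_evalRingHom_blowup a f
  obtain ⟨d, hd⟩ := exists_infinite_fiber_nat fun a =>
    max (P a (u a)).natDegree (P a (w a)).natDegree
  obtain ⟨U, V, hV, hUV⟩ := PowerSeries.exists_mul_eq_of_infinite F hd (d := d) fun a ha => by
    have ha' : max (P a (u a)).natDegree (P a (w a)).natDegree = d := ha
    refine ⟨P a (u a), P a (w a), fun h0 => ?_, ha' ▸ le_max_left _ _, ha' ▸ le_max_right _ _, ?_⟩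
    · have h1 : IsUnit (ev a (ψ (ι (w a)))) := ((IsLocalization.map_units A (w a)).map ψ).map (ev a)
      rw [hP, h0, Polynomial.coe_zero] at h1
      exact not_isUnit_zero h1
    · rw [← hP, ← hP, ← huw, map_mul, map_mul, hevF, mul_comm]
  obtain ⟨M, V', hV'⟩ := exists_blowup_eq_X_pow_mul V
  obtain ⟨N, U', hU'⟩ := exists_blowup_eq_X_pow_mul U
  have hV'0 : V' ≠ 0 := by
    rintro rfl
    rw [map_zero, zero_eq_mul, Polynomial.coe_eq_zero_iff] at hV'
    exact hV'.elim (pow_ne_zero _ PowerSeries.X_ne_zero) hV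
  set α : A := ι (X 0 ^ N * V') with hα
  set β : A := ι (X 0 ^ M * U') with hβ
  have hα0 : α ≠ 0 := (map_ne_zero_iff _ hinj).mpr (mul_ne_zero (pow_ne_zero _ (X_ne_zero 0)) hV'0)
  have hαβ : ψ α * F = ψ β := by
    rw [hψ, hψ, map_mul, map_mul, map_pow, map_pow, blowup_X_zero, hV', hU', ← hUV]
    ring
  have hdvd : ∀ s, s ≠ 0 → s ∣ α * g s - β := by
    refine hzero (fun s => α * g s - β) (fun s t ht hst => ?_) fun t n ht hnt => ?_
    · rw [sub_sub_sub_cancel_right, ← mul_sub]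
      exact (hg s t ht hst).mul_left _
    · rw [map_sub, map_mul, ← hαβ, ← mul_sub]
      exact (hF t n ht hnt).mul_left _
  obtain ⟨r, hr⟩ : α ∣ β := (dvd_sub_right (dvd_mul_right _ _)).mp (hdvd α hα0)
  refine ⟨r, fun s hs => ?_⟩
  have h1 := hdvd (α * s) (mul_ne_zero hα0 hs)
  rw [hr, ← mul_sub, mul_dvd_mul_iff_left hα0] at h1
  have h2 := hg s (α * s) (mul_ne_zero hα0 hs) (dvd_mul_left _ _)
  simpa using dvd_sub h1 h2

/-! ### Localizations of finite flat extensions -/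

/-- If `m` is generated by `p`, it is the only prime of `S` over `p`, so that `S` localized at `m`
is finite and flat over the local ring of `p`, hence free. -/
theorem HasCoherentLimits.localization_of_finite_of_flat {R S : Type*} [CommRing R] [IsDomain R]
    [CommRing S] [IsDomain S] {φ : R →+* S} (hfin : φ.Finite) (hflat : φ.Flat) {p : Ideal R}
    [p.IsMaximal] {m : Ideal S} [m.IsMaximal] (hm : m = p.map φ)
    (h : HasCoherentLimits (Localization.AtPrime p)) :
    HasCoherentLimits (Localization.AtPrime m) := by
  algebraize [φ]
  set M := Algebra.algebraMapSubmonoid S p.primeCompl with hMdef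
  have hcomap : m.comap φ = p :=
    (Ideal.IsMaximal.eq_of_le inferInstance (Ideal.comap_ne_top _ (Ideal.IsMaximal.ne_top ‹_›))
      (hm ▸ Ideal.le_comap_map)).symm
  have hM : M ≤ m.primeCompl := by
    rintro _ ⟨r, hr, rfl⟩ hrm
    exact hr (hcomap ▸ Ideal.mem_comap.mpr hrm)
  have hdvd : ∀ n ∈ m.primeCompl, ∃ r ∈ M, n ∣ r := by
    intro n hn
    by_contra! hcon
    have hle : (Ideal.span {n}).comap (algebraMap R S) ≤ p := by
      intro r hr
      by_contra hrp
      exact hcon _ ⟨r, hrp, rfl⟩ (Ideal.mem_span_singleton.mp hr)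
    obtain ⟨Q, hQ, hQprime, hQp⟩ := Ideal.exists_ideal_over_prime_of_isIntegral p _ hle
    have hmQ : m ≤ Q := hm ▸ Ideal.map_le_iff_le_comap.mpr hQp.ge
    have hmQ' : m = Q := Ideal.IsMaximal.eq_of_le ‹_› hQprime.ne_top hmQ
    exact hn (hmQ' ▸ hQ (Ideal.mem_span_singleton_self n))
  have hMnzd : M ≤ nonZeroDivisors S := hM.trans m.primeCompl_le_nonZeroDivisors
  have : IsDomain (Localization M) := IsLocalization.isDomain_localization hMnzd
  have : IsDomain (Localization.AtPrime p) :=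
    IsLocalization.isDomain_localization p.primeCompl_le_nonZeroDivisors
  have : Module.Free (Localization.AtPrime p) (Localization M) :=
    Module.free_of_flat_of_isLocalRing
  have : IsLocalization m.primeCompl (Localization M) :=
    IsLocalization.of_le_of_exists_dvd M _ hM hdvd
  exact (HasCoherentLimits.of_finite_free (A := Localization.AtPrime p) h).of_ringEquiv
    (IsLocalization.algEquiv m.primeCompl (Localization M) (Localization.AtPrime m)).toRingEquiv

namespace Polynomial

open scoped Bivariate
open Bivariate

/-- `R[X]` is free over its subring `R[P]`, being isomorphic to `R[T][X] / (P(X) - T)`. -/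
theorem compRingHom_finite_and_flat {R : Type*} [CommRing R] {P : R[X]} (hP : P.Monic)
    (hdeg : P.natDegree ≠ 0) : (compRingHom P).Finite ∧ (compRingHom P).Flat := by
  have : Nontrivial R := by
    by_contra h
    rw [not_nontrivial_iff_subsingleton] at h
    exact hdeg (natDegree_of_subsingleton)
  let Q : R[X][X] := P.map C - C X
  have hQ : Q.Monic := by
    refine (hP.map C).sub_of_left (degree_C_le.trans_lt ?_)
    rw [hP.degree_map, degree_eq_natDegree hP.ne_zero]
    exact_mod_cast Nat.pos_of_ne_zero hdeg
  have hQeval : ∀ {S : Type _} [CommRing S] (f : R[X] →+* S) (x : S),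
      Q.eval₂ f x = P.eval₂ (f.comp C) x - f X := fun f x => by
    rw [eval₂_sub, eval₂_map, eval₂_C]
  let f : AdjoinRoot Q →+* R[X] := AdjoinRoot.lift (compRingHom P) X (by
    rw [hQeval, sub_eq_zero]
    have : (compRingHom P).comp C = C := RingHom.ext fun x => by simp
    rw [this, eval₂_C_X]
    simp)
  let g : R[X] →+* AdjoinRoot Q := eval₂RingHom ((AdjoinRoot.of Q).comp C) (AdjoinRoot.root Q)
  have hfg : f.comp g = RingHom.id _ := by
    refine ringHom_ext' (RingHom.ext fun c => ?_) ?_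
    · simp [f, g]
    · simp [f, g]
  have hgf : g.comp f = RingHom.id _ := by
    refine AdjoinRoot.ringHom_ext (ringHom_ext' (RingHom.ext fun c => ?_) ?_) ?_
    · simp [f, g]
    · have h := AdjoinRoot.eval₂_root Q
      rw [hQeval, sub_eq_zero] at h
      simpa [f, g] using h
    · simp [f, g]
  let e : AdjoinRoot Q ≃+* R[X] := RingEquiv.ofRingHom f g hfg hgf
  have he : (compRingHom P) = (e : AdjoinRoot Q →+* R[X]).comp (AdjoinRoot.of Q) := by
    ext x <;> simp [e, f]
  have hfree := hQ.free_adjoinRoot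
  have hfinite := hQ.finite_adjoinRoot
  rw [he]
  refine ⟨RingHom.Finite.comp (RingHom.Finite.of_surjective _ e.surjective) ?_,
    RingHom.Flat.comp ?_ (RingHom.Flat.of_bijective e.bijective)⟩
  · exact RingHom.finite_algebraMap.mpr hfinite
  · exact RingHom.flat_algebraMap_iff.mpr inferInstance

variable {k : Type*} [Field k]

theorem exists_monic_span_eq {I : Ideal k[X]} [hI : I.IsMaximal] :
    ∃ p : k[X], p.Monic ∧ p.natDegree ≠ 0 ∧ I = Ideal.span {p} := by
  classical
  have hbot : I ≠ ⊥ := Ring.ne_bot_of_isMaximal_of_not_isField hI (Polynomial.not_isField k)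
  obtain ⟨p₀, hp₀⟩ := (IsPrincipalIdealRing.principal I).principal
  have hp₀' : p₀ ≠ 0 := by
    rintro rfl
    exact hbot (by simpa using hp₀)
  have hspan : I = Ideal.span {normalize p₀} := by
    rw [hp₀]
    exact (Ideal.span_singleton_eq_span_singleton.mpr (normalize_associated p₀)).symm
  refine ⟨normalize p₀, monic_normalize hp₀', fun h0 => hI.ne_top ?_, hspan⟩
  rw [hspan, eq_one_of_monic_natDegree_zero (monic_normalize hp₀') h0, Ideal.span_singleton_one]

/-- Every maximal ideal of `k[X, Y]` is generated by a polynomial in `X` and a polynomial which is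
monic in `Y`. -/
theorem exists_monic_span_pair_eq (m : Ideal k[X][Y]) [hm : m.IsMaximal] :
    ∃ (p : k[X]) (q : k[X][Y]), p.Monic ∧ q.Monic ∧ p.natDegree ≠ 0 ∧ q.natDegree ≠ 0 ∧
      m = Ideal.span {q, C p} := by
  have hn : (m.comap (C : k[X] →+* k[X][Y])).IsMaximal := isMaximal_comap_C_of_isJacobsonRing m
  set n := m.comap (C : k[X] →+* k[X][Y]) with hndef
  obtain ⟨p, hp, hpdeg, hnp⟩ := exists_monic_span_eq (I := n)
  let : Field (k[X] ⧸ n) := Ideal.Quotient.field n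
  let π : k[X][Y] →+* (k[X] ⧸ n)[X] := mapRingHom (Ideal.Quotient.mk n)
  have hπ : Function.Surjective π := map_surjective _ Ideal.Quotient.mk_surjective
  have hker : RingHom.ker π = n.map C := by
    rw [ker_mapRingHom, Ideal.mk_ker]
  have hkerle : RingHom.ker π ≤ m := hker ▸ Ideal.map_comap_le
  have hmπ : (m.map π).comap π = m := by
    rw [Ideal.comap_map_of_surjective' π hπ, sup_eq_left.mpr hkerle]
  have hmax : (m.map π).IsMaximal :=
    (Ideal.map_eq_top_or_isMaximal_of_surjective π hπ hm).resolve_left fun htop =>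
      hm.ne_top (by rw [← hmπ, htop, Ideal.comap_top])
  obtain ⟨q₀, hq₀, hqdeg, hmq⟩ := exists_monic_span_eq (I := m.map π)
  obtain ⟨q, hqmap, hqdeg', hq⟩ := lifts_and_natDegree_eq_and_monic
    (f := Ideal.Quotient.mk n) (p := q₀) (by
      obtain ⟨q, hq⟩ := hπ q₀
      exact (mem_lifts _).mpr ⟨q, hq⟩) hq₀
  refine ⟨p, q, hp, hq, hpdeg, hqdeg' ▸ hqdeg, ?_⟩
  have h1 : (Ideal.span {q}).map π = m.map π := by
    rw [Ideal.map_span, Set.image_singleton, hmq]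
    exact congrArg (fun x => Ideal.span {x}) hqmap
  rw [← hmπ, ← h1, Ideal.comap_map_of_surjective' π hπ, hker, hnp, Ideal.map_span,
    Set.image_singleton, Ideal.span_insert]

/-- Every maximal ideal of `k[X, Y]` is generated by the images of the two variables under a finite
flat endomorphism of `k[X, Y]`. -/
theorem exists_finite_flat_map_idealOfVars_eq (m : Ideal k[X][Y]) [m.IsMaximal] :
    ∃ φ : MvPolynomial (Fin 2) k →+* k[X][Y], φ.Finite ∧ φ.Flat ∧
      m = (MvPolynomial.idealOfVars (Fin 2) k).map φ := by
  obtain ⟨p, q, hp, hq, hpdeg, hqdeg, hm⟩ := exists_monic_span_pair_eq m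
  obtain ⟨hfin₁, hflat₁⟩ := compRingHom_finite_and_flat (hp.map C)
    (by rwa [hp.natDegree_map])
  obtain ⟨hfin₂, hflat₂⟩ := compRingHom_finite_and_flat hq hqdeg
  let e : MvPolynomial (Fin 2) k ≃+* k[X][Y] := (equivMvPolynomial k).symm.toRingEquiv
  let σ : k[X][Y] ≃+* k[X][Y] := (Bivariate.swap (R := k)).toRingEquiv
  -- The variables are sent first to `(X, p(Y))`, then to `(Y, p(X))`, then to `(q, p(X))`.
  refine ⟨(compRingHom q).comp ((σ : k[X][Y] →+* k[X][Y]).comp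
    ((compRingHom (p.map C)).comp (e : MvPolynomial (Fin 2) k →+* k[X][Y]))), ?_, ?_, ?_⟩
  · exact hfin₂.comp ((RingHom.Finite.of_surjective _ σ.surjective).comp
      (hfin₁.comp (RingHom.Finite.of_surjective _ e.surjective)))
  · exact .comp (.comp (.comp (.of_bijective e.bijective) hflat₁) (.of_bijective σ.bijective))
      hflat₂
  · rw [hm, Ideal.map_span]
    congr 1
    have h0 : e (MvPolynomial.X 0) = C X := equivMvPolynomial_symm_X_0
    have h1 : e (MvPolynomial.X 1) = X := equivMvPolynomial_symm_X_1
    have h2 : σ (C X) = X := Bivariate.swap_X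
    have h3 : σ (p.map C) = C p := Bivariate.swap_map_C p
    rw [← Set.range_comp]
    ext x
    simp [Fin.exists_fin_two, h0, h1, h2, h3, eq_comm]

end Polynomial

/-! ### The completeness theorem -/

theorem lemma12 (k : Type*) [Field k] (hk : Cardinal.aleph 1 ≤ Cardinal.mk k) :
    IsDivisibilityComplete (MvPolynomial (Fin 2) k) ∧
      ∀ (m : Ideal (MvPolynomial (Fin 2) k)) [m.IsMaximal],
        IsDivisibilityComplete (Localization.AtPrime m) := by
  have : Uncountable k := Cardinal.aleph0_lt_mk_iff.mp
    ((Cardinal.aleph_zero ▸ Cardinal.aleph_lt_aleph.mpr zero_lt_one).trans_le hk)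
  let e := (Polynomial.Bivariate.equivMvPolynomial k).toRingEquiv
  have hfield : ¬ IsField (MvPolynomial (Fin 2) k) := fun h =>
    Polynomial.not_isField (Polynomial k) (e.toMulEquiv.isField h)
  refine ⟨(Polynomial.hasCoherentLimits_bivariate.of_ringEquiv e).isDivisibilityComplete hfield,
    fun m hm => ?_⟩
  have : IsDomain (Localization.AtPrime m) :=
    IsLocalization.isDomain_localization m.primeCompl_le_nonZeroDivisors
  refine HasCoherentLimits.isDivisibilityComplete ?_ (IsLocalization.AtPrime.not_isField _
    (Ring.ne_bot_of_isMaximal_of_not_isField hm hfield) _)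
  have : (m.comap (e : Polynomial (Polynomial k) →+* MvPolynomial (Fin 2) k)).IsMaximal :=
    Ideal.comap_isMaximal_of_surjective _ e.surjective
  obtain ⟨φ, hfin, hflat, hφ⟩ := Polynomial.exists_finite_flat_map_idealOfVars_eq
    (m.comap (e : Polynomial (Polynomial k) →+* MvPolynomial (Fin 2) k))
  refine ((hasCoherentLimits_localization_origin (k := k)).localization_of_finite_of_flat
    hfin hflat hφ).of_ringEquiv (IsLocalization.ringEquivOfRingEquiv _ _ e
      (M := (m.comap (e : Polynomial (Polynomial k) →+* MvPolynomial (Fin 2) k)).primeCompl)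
      (T := m.primeCompl) ?_)
  ext x
  constructor
  · rintro ⟨y, hy, rfl⟩
    exact hy
  · intro hx
    exact ⟨e.symm x, fun h => hx (by simpa using h), by simp⟩
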